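/- Assume the Diamond Principle $\Diamond$: there is a sequence $\langle f_\alpha : \omega\le\alpha<\omega_1\rangle$ with $f_\alpha\in(2^\alpha)^\omega$ such that for every $f\in(2^{\omega_1})^\omega$ the set $\{\alpha\in[\omega,\omega_1) : f(n)\restriction\alpha=f_\alpha(n)\text{ for all }n\in\omega\}$ is stationary in $\omega_1$. Then there exists an infinite Boolean algebra $\mathcal A$ with the following two properties. (1) $\mathcal A$ has the Nikodym property: if $(\mu_n)_{n\in\omega}$ is a sequence of bounded finitely additive signed measures on $\mathcal A$ with $\sup_n|\mu_n(A)|<\infty$ for every $A\in\mathcal A$, then $\sup_n\|\mu_n\|<\infty$, where $\|\mu\|=\sup\{|\mu(A)|+|\mu(B)| : A,B\in\mathcal A,\ A\wedge B=0\}$. (2) Every Radon (that is, regular Borel) probability measure $\mu$ on the Stone space $St(\mathcal A)$ of all ultrafilters on $\mathcal A$ has countable Maharam type, where the Maharam type of $\mu$ is the minimal cardinality of a family $\mathcal C$ of Borel subsets of $St(\mathcal A)$ such that for every Borel set $B\subseteq St(\mathcal A)$ and every $\varepsilon>0$ there is $C\in\mathcal C$ with $\mu(B\triangle C)<\varepsilon$;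 countable means at most $\aleph_0$. -/

import Mathlib

open MeasureTheory

/-- The Diamond Principle: there are `f_α ∈ (2^α)^ω`, for `ω ≤ α < ω₁`, such that every
`g ∈ (2^{ω₁})^ω` satisfies `g(n) ↾ α = f_α(n)` for all `n`, for stationarily many `α`.
The ordinal `ω₁` is represented by the linear order `Set.Iio ω₁` of all ordinals below it. -/
def DiamondPrinciple : Prop :=
  ∃ f : (α : Set.Iio (Ordinal.omega.{0} 1)) → Ordinal.omega0 ≤ α.1 → ℕ → (Set.Iio α → Bool),
    ∀ g : ℕ → Set.Iio (Ordinal.omega.{0} 1) → Bool,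
      IsStationary {α : Set.Iio (Ordinal.omega.{0} 1) |
        ∃ hα : Ordinal.omega0 ≤ α.1, ∀ n : ℕ, ∀ β : Set.Iio α, g n β.1 = f α hα n β}

/-- Bounded finitely additive signed measures on a Boolean algebra. -/
structure FinAddSignedMeasure (A : Type*) [BooleanAlgebra A] where
  toFun : A → ℝ
  map_sup_of_disjoint : ∀ a b : A, Disjoint a b → toFun (a ⊔ b) = toFun a + toFun b
  bounded : BddAbove {r : ℝ | ∃ a b : A, Disjoint a b ∧ r = |toFun a| + |toFun b|}

/-- The total variation norm
`‖μ‖ = sup {|μ(a)| + |μ(b)| : a ∧ b = 0}`. -/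
noncomputable def FinAddSignedMeasure.variation {A : Type*} [BooleanAlgebra A]
    (μ : FinAddSignedMeasure A) : ℝ :=
  sSup {r : ℝ | ∃ a b : A, Disjoint a b ∧ r = |μ.toFun a| + |μ.toFun b|}

/-- The Nikodym property: every pointwise bounded sequence of measures is uniformly bounded. -/
def NikodymProperty (A : Type*) [BooleanAlgebra A] : Prop :=
  ∀ μ : ℕ → FinAddSignedMeasure A,
    (∀ a : A, BddAbove (Set.range fun n => |(μ n).toFun a|)) →
      BddAbove (Set.range fun n => (μ n).variation)

/-- The Stone space of a Boolean algebra: the set of all its ultrafilters. -/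
def StoneSpace (A : Type*) [BooleanAlgebra A] : Type _ :=
  {F : Order.PFilter A // ⊥ ∉ F ∧ ∀ a : A, a ∈ F ∨ aᶜ ∈ F}

/-- The Stone topology, generated by the sets of all ultrafilters containing a given element. -/
instance StoneSpace.instTopologicalSpace (A : Type*) [BooleanAlgebra A] :
    TopologicalSpace (StoneSpace A) :=
  TopologicalSpace.generateFrom (Set.range fun a : A => {x : StoneSpace A | a ∈ x.1})

/-- The Stone space carries its Borel `σ`-algebra. -/
instance StoneSpace.instMeasurableSpace (A : Type*) [BooleanAlgebra A] :
    MeasurableSpace (StoneSpace A) :=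
  borel (StoneSpace A)

instance StoneSpace.instBorelSpace (A : Type*) [BooleanAlgebra A] :
    BorelSpace (StoneSpace A) :=
  ⟨rfl⟩

/-- The Maharam type of a measure: the minimal cardinality of a family `C` of measurable sets
that is dense in the measurable sets for the pseudometric `μ(B ∆ C)`. -/
noncomputable def maharamType {X : Type*} [MeasurableSpace X] (μ : Measure X) : Cardinal :=
  sInf {κ : Cardinal | ∃ C : Set (Set X), (∀ c ∈ C, MeasurableSet c) ∧
    (∀ B : Set X, MeasurableSet B → ∀ ε : ENNReal, 0 < ε → ∃ c ∈ C, μ (symmDiff B c) < ε) ∧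
    Cardinal.mk C = κ}

/-! The algebra consists of subsets of `ℕ` and is generated by the singletons and sets `x α`, `α <
ω₁`, chosen recursively. Let `A_α` be generated by the singletons and the earlier `x β`. If the
diamond guess at `α` codes a sequence of set functions on `A_α` that some set destroys, then `x α`
is such a set; otherwise it is empty. A destroying set splits at most one ultrafilter of `A_α`, the
one generated by its base `b`.

Both properties rest on one stabilization argument. For a nonnegative additive `l`, the energy of
`l` on `A_α` decreases with `α` and is constant from a countable stage on. Splitting the mass at an
ultrafilter would lower it, so from then on `l (b k ∩ x α)` or `l (b k \ x α)` tends to 0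
(`exists_forall_not_split`). Hence `x α` is approximated in `l` by the members `x α \ b k` or `x α ∪
b k` of `A_α`, and by induction a countable stage is `l`-dense (`exists_dense_stage`). This gives
countable Maharam type.

For the Nikodym property, suppose `ν` is pointwise but not uniformly bounded, and let `l` control
all `ν n`. By a gliding hump, `exists_destroys` provides a destroying set on every countable stage
that sees the unboundedness. At a late stage where diamond guesses the code of `ν`, the set `x α`
destroys `ν`; since `ν n (x α)` is approximated from inside or outside along `b`, the values at `x
α` are unbounded, a contradiction. Which side approximates is not known when `x α` is chosen, so
`Destroys` asks for large values on both. -/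

open Filter

/-! ### Additive set functions, variation and control -/

/-- Finite additivity of a real set function on an algebra of sets. -/
def AdditiveOn {X : Type*} (B : BooleanSubalgebra (Set X)) (ν : Set X → ℝ) : Prop :=
  ∀ a ∈ B, ∀ b ∈ B, Disjoint a b → ν (a ∪ b) = ν a + ν b

namespace AdditiveOn

variable {X : Type*} {B B' : BooleanSubalgebra (Set X)} {ν : Set X → ℝ}

theorem mono (h : AdditiveOn B' ν) (hB : B ≤ B') : AdditiveOn B ν :=
  fun a ha b hb => h a (hB ha) b (hB hb)

theorem neg (h : AdditiveOn B ν) : AdditiveOn B fun a => -ν a := by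
  intro a ha b hb hab
  have := h a ha b hb hab
  simp only
  linarith

theorem empty (h : AdditiveOn B ν) : ν ∅ = 0 := by
  have := h ∅ B.bot_mem ∅ B.bot_mem (by simp)
  simp only [Set.union_self] at this
  linarith

theorem inter_add_sdiff (h : AdditiveOn B ν) {a b : Set X} (ha : a ∈ B) (hb : b ∈ B) :
    ν (a ∩ b) + ν (a \ b) = ν a := by
  rw [← h (a ∩ b) (B.infClosed ha hb) (a \ b) (BooleanSubalgebra.sdiff_mem ha hb)
    (Set.disjoint_sdiff_inter.symm), Set.inter_union_sdiff]

theorem le_of_subset (h : AdditiveOn B ν) (hpos : ∀ a ∈ B, 0 ≤ ν a) {a b : Set X}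
    (ha : a ∈ B) (hb : b ∈ B) (hab : a ⊆ b) : ν a ≤ ν b := by
  have h1 := h.inter_add_sdiff hb ha
  rw [Set.inter_eq_self_of_subset_right hab] at h1
  linarith [hpos _ (BooleanSubalgebra.sdiff_mem hb ha)]

theorem union_le (h : AdditiveOn B ν) (hpos : ∀ a ∈ B, 0 ≤ ν a) {a b : Set X}
    (ha : a ∈ B) (hb : b ∈ B) : ν (a ∪ b) ≤ ν a + ν b := by
  have h1 := h a ha (b \ a) (BooleanSubalgebra.sdiff_mem hb ha) Set.disjoint_sdiff_right
  rw [Set.union_sdiff_self] at h1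
  linarith [h.le_of_subset hpos (BooleanSubalgebra.sdiff_mem hb ha) hb Set.sdiff_subset]

end AdditiveOn

/-- The upper variation of a set function on an algebra of sets. -/
noncomputable def upperVariation {X : Type*} (B : BooleanSubalgebra (Set X)) (ν : Set X → ℝ)
    (a : Set X) : ℝ :=
  sSup (ν '' {b | b ∈ B ∧ b ⊆ a})

section upperVariation

variable {X : Type*} {B : BooleanSubalgebra (Set X)} {ν : Set X → ℝ} {M : ℝ}

theorem le_upperVariation (hM : ∀ a ∈ B, |ν a| ≤ M) {a b : Set X} (hb : b ∈ B) (hba : b ⊆ a) :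
    ν b ≤ upperVariation B ν a := by
  refine le_csSup ⟨M, ?_⟩ ⟨b, ⟨hb, hba⟩, rfl⟩
  rintro _ ⟨c, hc, rfl⟩
  exact (le_abs_self _).trans (hM c hc.1)

theorem upperVariation_le {a : Set X} {C : ℝ} (hC : ∀ b ∈ B, b ⊆ a → ν b ≤ C) :
    upperVariation B ν a ≤ C := by
  refine csSup_le ⟨_, ∅, ⟨B.bot_mem, by simp⟩, rfl⟩ ?_
  rintro _ ⟨c, hc, rfl⟩
  exact hC c hc.1 hc.2

/-- Subsets of a disjoint union are exactly the unions of a subset of each part, so the two suprema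
add. -/
theorem AdditiveOn.upperVariation (h : AdditiveOn B ν) (hM : ∀ a ∈ B, |ν a| ≤ M) :
    AdditiveOn B (upperVariation B ν) := by
  intro a ha b hb hab
  apply le_antisymm
  · refine upperVariation_le fun c hc hcab => ?_
    rw [← h.inter_add_sdiff hc ha]
    refine add_le_add (le_upperVariation hM (B.infClosed hc ha) Set.inter_subset_right)
      (le_upperVariation hM (BooleanSubalgebra.sdiff_mem hc ha) ?_)
    rw [Set.sdiff_subset_iff]
    exact hcab
  · rw [← le_sub_iff_add_le]
    refine upperVariation_le fun c hc hca => ?_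
    rw [le_sub_comm]
    refine upperVariation_le fun d hd hdb => ?_
    rw [le_sub_iff_add_le, add_comm, ← h c hc d hd (hab.mono hca hdb)]
    exact le_upperVariation hM (B.supClosed hc hd) (Set.union_subset_union hca hdb)

/-- A bounded additive set function is dominated by a nonnegative bounded one. -/
theorem AdditiveOn.exists_dominating (h : AdditiveOn B ν) (hM : ∀ a ∈ B, |ν a| ≤ M) :
    ∃ v : Set X → ℝ, AdditiveOn B v ∧ (∀ a, 0 ≤ v a) ∧ (∀ a ∈ B, |ν a| ≤ v a) ∧
      ∀ a, v a ≤ 2 * M := by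
  have hM' : ∀ a ∈ B, |(fun a => -ν a) a| ≤ M := by simpa using hM
  have h1 := h.upperVariation hM
  have h2 := h.neg.upperVariation hM'
  have p1 : ∀ a, 0 ≤ _root_.upperVariation B ν a := fun a => by
    simpa [h.empty] using le_upperVariation hM B.bot_mem (Set.empty_subset a)
  have p2 : ∀ a, 0 ≤ _root_.upperVariation B (fun a => -ν a) a := fun a => by
    simpa [h.empty] using le_upperVariation hM' B.bot_mem (Set.empty_subset a)
  -- The dominating function is the total variation, positive part plus negative part.
  refine ⟨fun a => _root_.upperVariation B ν a + _root_.upperVariation B (fun a => -ν a) a,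
    ?_, fun a => add_nonneg (p1 a) (p2 a), fun a ha => ?_, fun a => ?_⟩
  · intro a ha b hb hab
    simp only [h1 a ha b hb hab, h2 a ha b hb hab]
    ring
  · have q1 := le_upperVariation hM ha subset_rfl
    have q2 := le_upperVariation hM' ha subset_rfl
    rw [abs_le]
    constructor <;> linarith [p1 a, p2 a]
  · have q1 : _root_.upperVariation B ν a ≤ M :=
      upperVariation_le fun b hb _ => (le_abs_self _).trans (hM b hb)
    have q2 : _root_.upperVariation B (fun a => -ν a) a ≤ M :=
      upperVariation_le fun b hb _ => (le_abs_self _).trans (hM' b hb)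
    linarith

/-- A sequence of bounded additive set functions has a common control function. -/
theorem exists_control {ν : ℕ → Set X → ℝ} (h : ∀ n, AdditiveOn B (ν n))
    (hM : ∀ n, ∃ M, ∀ a ∈ B, |ν n a| ≤ M) :
    ∃ l : Set X → ℝ, AdditiveOn B l ∧ (∀ a ∈ B, 0 ≤ l a) ∧
      ∀ n, ∃ K, 0 < K ∧ ∀ a ∈ B, |ν n a| ≤ K * l a := by
  choose M hM using hM
  choose v hadd hpos hdom hle using fun n => (h n).exists_dominating (hM n)
  have hM0 : ∀ n, 0 ≤ M n := fun n => (abs_nonneg _).trans (hM n ∅ B.bot_mem)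
  -- The weights make the series of the dominating functions, each at most `2 * M n`, converge
  -- geometrically.
  set w : ℕ → ℝ := fun n => (1 / 2) ^ n / (2 * M n + 1) with hw
  have hwpos : ∀ n, 0 < w n := fun n => by have := hM0 n; positivity
  have hterm : ∀ a n, w n * v n a ≤ (1 / 2) ^ n := fun a n => by
    have h0 := hM0 n
    rw [hw, div_mul_eq_mul_div, div_le_iff₀ (by positivity)]
    exact mul_le_mul_of_nonneg_left (by linarith [hle n a]) (by positivity)
  have hnn : ∀ a n, 0 ≤ w n * v n a := fun a n => mul_nonneg (hwpos n).le (hpos n a)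
  have hsum : ∀ a, Summable fun n => w n * v n a := fun a =>
    Summable.of_nonneg_of_le (hnn a) (hterm a) summable_geometric_two
  refine ⟨fun a => ∑' n, w n * v n a, ?_, fun a _ => tsum_nonneg (hnn a), fun n => ?_⟩
  · intro a ha b hb hab
    simp only
    rw [← (hsum a).tsum_add (hsum b)]
    refine tsum_congr fun n => ?_
    rw [hadd n a ha b hb hab, mul_add]
  · refine ⟨(w n)⁻¹, inv_pos.2 (hwpos n), fun a ha => (hdom n a ha).trans ?_⟩
    rw [← div_le_iff₀' (inv_pos.2 (hwpos n)), div_inv_eq_mul, mul_comm]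
    exact (hsum a).le_tsum n fun m _ => hnn a m

end upperVariation

/-! ### Ultrafilter bases and energy -/

/-- A decreasing sequence of elements of `B` generating an ultrafilter of `B`. -/
structure IsUltrafilterBase {X : Type*} (B : BooleanSubalgebra (Set X)) (b : ℕ → Set X) :
    Prop where
  anti : Antitone b
  mem : ∀ k, b k ∈ B
  decide : ∀ c ∈ B, ∃ k, b k ⊆ c ∨ Disjoint (b k) c

/-- Sums of squares of a set function over the finite partitions into members of `B`. -/
def partitionSums {X : Type*} (B : BooleanSubalgebra (Set X)) (l : Set X → ℝ) : Set ℝ :=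
  {e | ∃ (ι : Type) (_ : Fintype ι) (f : X → ι), (∀ i, f ⁻¹' {i} ∈ B) ∧
    e = ∑ i, l (f ⁻¹' {i}) ^ 2}

/-- The infimum of the sums of squares over finite partitions: the sum of the squares of the
masses of the atoms. -/
noncomputable def energy {X : Type*} (B : BooleanSubalgebra (Set X)) (l : Set X → ℝ) : ℝ :=
  sInf (partitionSums B l)

section energy

variable {X : Type*} {B B' : BooleanSubalgebra (Set X)} {l : Set X → ℝ}

theorem nonneg_of_mem_partitionSums {e : ℝ} (he : e ∈ partitionSums B l) : 0 ≤ e := by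
  obtain ⟨ι, _, f, -, rfl⟩ := he
  positivity

theorem bddBelow_partitionSums : BddBelow (partitionSums B l) :=
  ⟨0, fun _ => nonneg_of_mem_partitionSums⟩

theorem partitionSums_nonempty : (partitionSums B l).Nonempty :=
  ⟨_, Unit, inferInstance, fun _ => (), fun i => by
    convert! B.top_mem
    ext; simp, rfl⟩

theorem energy_nonneg : 0 ≤ energy B l :=
  Real.sInf_nonneg fun _ => nonneg_of_mem_partitionSums

theorem energy_anti (h : B ≤ B') : energy B' l ≤ energy B l := by
  refine csInf_le_csInf bddBelow_partitionSums partitionSums_nonempty ?_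
  rintro _ ⟨ι, _, f, hf, rfl⟩
  exact ⟨ι, _, f, fun i => h (hf i), rfl⟩

/-- Splitting an atom lowers the energy. -/
theorem energy_le_sub {x : Set X} {b : ℕ → Set X} (hB : B ≤ B') (hx : x ∈ B')
    (hl : AdditiveOn B' l) (hpos : ∀ a ∈ B', 0 ≤ l a) (hb : IsUltrafilterBase B b) {r s : ℝ}
    (hr : 0 < r) (hs : 0 < s) (hbr : ∀ k, r ≤ l (b k ∩ x)) (hbs : ∀ k, s ≤ l (b k \ x)) :
    energy B' l ≤ energy B l - 2 * (r * s) := by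
  rw [le_sub_iff_add_le]
  refine le_csInf partitionSums_nonempty ?_
  rintro _ ⟨ι, _, f, hf, rfl⟩
  classical
  rw [← le_sub_iff_add_le]
  have hsplit : ∀ i, l (f ⁻¹' {i} ∩ x) + l (f ⁻¹' {i} \ x) = l (f ⁻¹' {i}) := fun i =>
    hl.inter_add_sdiff (hB (hf i)) hx
  have hmem1 : ∀ i, f ⁻¹' {i} ∩ x ∈ B' := fun i => B'.infClosed (hB (hf i)) hx
  have hmem2 : ∀ i, f ⁻¹' {i} \ x ∈ B' := fun i => BooleanSubalgebra.sdiff_mem (hB (hf i)) hx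
  -- Some cell belongs to the ultrafilter: far enough along, `b m` is decided by every cell, and it
  -- is nonempty because it has positive mass. Cutting this cell by `x` replaces `(p + q) ^ 2` by `p
  -- ^ 2 + q ^ 2`, a drop of at least `2 * (r * s)`.
  obtain ⟨i₀, k, hk⟩ : ∃ i₀ k, b k ⊆ f ⁻¹' {i₀} := by
    choose k hk using fun i => hb.decide _ (hf i)
    obtain ⟨m, hm⟩ : ∃ m, ∀ i, k i ≤ m := by
      obtain ⟨m, hm⟩ := (Set.finite_range k).bddAbove
      exact ⟨m, fun i => hm ⟨i, rfl⟩⟩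
    have hne : (b m).Nonempty := by
      rw [Set.nonempty_iff_ne_empty]
      intro h0
      have := hbr m
      rw [h0, Set.empty_inter, hl.empty] at this
      linarith
    obtain ⟨t, ht⟩ := hne
    refine ⟨f t, k (f t), (hk (f t)).resolve_right fun hd => ?_⟩
    exact Set.disjoint_left.1 hd (hb.anti (hm _) ht) rfl
  have hr0 : r ≤ l (f ⁻¹' {i₀} ∩ x) := (hbr k).trans
    (hl.le_of_subset hpos (B'.infClosed (hB (hb.mem k)) hx) (hmem1 i₀)
      (Set.inter_subset_inter_left _ hk))
  have hs0 : s ≤ l (f ⁻¹' {i₀} \ x) := (hbs k).trans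
    (hl.le_of_subset hpos (BooleanSubalgebra.sdiff_mem (hB (hb.mem k)) hx) (hmem2 i₀)
      (Set.sdiff_subset_sdiff_left hk))
  have hprod : r * s ≤ l (f ⁻¹' {i₀} ∩ x) * l (f ⁻¹' {i₀} \ x) :=
    mul_le_mul hr0 hs0 hs.le (hr.le.trans hr0)
  have hsum : ∑ i, (l (f ⁻¹' {i} ∩ x) ^ 2 + l (f ⁻¹' {i} \ x) ^ 2) ≤
      ∑ i, l (f ⁻¹' {i}) ^ 2 - 2 * (r * s) := by
    have h1 : r * s ≤ ∑ i, l (f ⁻¹' {i} ∩ x) * l (f ⁻¹' {i} \ x) :=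
      hprod.trans (Finset.single_le_sum
        (f := fun i => l (f ⁻¹' {i} ∩ x) * l (f ⁻¹' {i} \ x))
        (fun i _ => mul_nonneg (hpos _ (hmem1 i)) (hpos _ (hmem2 i))) (Finset.mem_univ i₀))
    have h2 : ∑ i, l (f ⁻¹' {i}) ^ 2 = ∑ i, (l (f ⁻¹' {i} ∩ x) ^ 2 + l (f ⁻¹' {i} \ x) ^ 2) +
        2 * ∑ i, l (f ⁻¹' {i} ∩ x) * l (f ⁻¹' {i} \ x) := by
      rw [Finset.mul_sum, ← Finset.sum_add_distrib]
      refine Finset.sum_congr rfl fun i _ => ?_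
      rw [← hsplit i]
      ring
    linarith
  refine (csInf_le bddBelow_partitionSums ?_).trans hsum
  have e1 : ∀ i, (fun t => (f t, decide (t ∈ x))) ⁻¹' {(i, true)} = f ⁻¹' {i} ∩ x := fun i => by
    ext t; simp
  have e2 : ∀ i, (fun t => (f t, decide (t ∈ x))) ⁻¹' {(i, false)} = f ⁻¹' {i} \ x := fun i => by
    ext t; simp
  refine ⟨ι × Bool, inferInstance, fun t => (f t, decide (t ∈ x)), ?_, ?_⟩
  · rintro ⟨i, _ | _⟩
    · rw [e2]; exact hmem2 i
    · rw [e1]; exact hmem1 i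
  · rw [Fintype.sum_prod_type]
    refine Finset.sum_congr rfl fun i _ => ?_
    rw [Fintype.sum_bool, e1, e2]

/-- If the energy does not drop, then adjoining `x` does not split the mass of the ultrafilter
generated by `b`. -/
theorem tendsto_inter_or_tendsto_sdiff {x : Set X} {b : ℕ → Set X} (hB : B ≤ B') (hx : x ∈ B')
    (hl : AdditiveOn B' l) (hpos : ∀ a ∈ B', 0 ≤ l a) (hb : IsUltrafilterBase B b)
    (he : energy B l ≤ energy B' l) :
    (∀ ε > 0, ∀ᶠ k in atTop, l (b k ∩ x) < ε) ∨ (∀ ε > 0, ∀ᶠ k in atTop, l (b k \ x) < ε) := by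
  by_contra hcon
  push Not at hcon
  obtain ⟨⟨r, hr, hr'⟩, ⟨s, hs, hs'⟩⟩ := hcon
  have key := energy_le_sub hB hx hl hpos hb hr hs (fun k => ?_) (fun k => ?_)
  · nlinarith [mul_pos hr hs]
  · obtain ⟨m, hm, hm'⟩ := (frequently_atTop.1 hr') k
    exact hm'.trans (hl.le_of_subset hpos (B'.infClosed (hB (hb.mem m)) hx)
      (B'.infClosed (hB (hb.mem k)) hx) (Set.inter_subset_inter_left _ (hb.anti hm)))
  · obtain ⟨m, hm, hm'⟩ := (frequently_atTop.1 hs') k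
    exact hm'.trans (hl.le_of_subset hpos (BooleanSubalgebra.sdiff_mem (hB (hb.mem m)) hx)
      (BooleanSubalgebra.sdiff_mem (hB (hb.mem k)) hx) (Set.sdiff_subset_sdiff_left (hb.anti hm)))

end energy

/-! ### Destroying sets and the gliding hump -/

/-- The set `x` is a union of members of `B` accumulating only at the ultrafilter generated by
`b`, and the sequence `ν` is unbounded both on the approximations `x \ b k` and on the
approximations `x ∪ b k` of `x`. -/
structure Destroys {X : Type*} (B : BooleanSubalgebra (Set X)) (ν : ℕ → Set X → ℝ)
    (x : Set X) (b : ℕ → Set X) : Prop where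
  base : IsUltrafilterBase B b
  sdiff_mem : ∀ k, x \ b k ∈ B
  sdiff_large : ∀ C : ℝ, ∃ n, ∃ᶠ k in atTop, C < |ν n (x \ b k)|
  union_large : ∀ C : ℝ, ∃ n, ∃ᶠ k in atTop, C < |ν n (x ∪ b k)|

section Destroys

variable {X : Type*} {B : BooleanSubalgebra (Set X)} {ν : ℕ → Set X → ℝ}

theorem union_mem_of_sdiff_mem {x : Set X} {b : Set X} (hb : b ∈ B) (hx : x \ b ∈ B) :
    x ∪ b ∈ B := by
  rw [← Set.sdiff_union_self]
  exact B.supClosed hx hb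

/-- The sequence `ν` is not uniformly bounded on the members of `B` below `c`. -/
def UnboundedBelow (B : BooleanSubalgebra (Set X)) (ν : ℕ → Set X → ℝ) (c : Set X) : Prop :=
  ∀ M : ℝ, ∃ n, ∃ a ∈ B, a ⊆ c ∧ M < |ν n a|

theorem UnboundedBelow.inter_or_sdiff (hadd : ∀ n, AdditiveOn B (ν n)) {c e : Set X}
    (h : UnboundedBelow B ν c) (he : e ∈ B) :
    UnboundedBelow B ν (c ∩ e) ∨ UnboundedBelow B ν (c \ e) := by
  by_contra hcon
  simp only [UnboundedBelow] at hcon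
  push Not at hcon
  obtain ⟨⟨M, hM⟩, ⟨N, hN⟩⟩ := hcon
  obtain ⟨n, a, ha, hac, hlt⟩ := h (M + N)
  have h1 := hM n (a ∩ e) (B.infClosed ha he) (Set.inter_subset_inter_left _ hac)
  have h2 := hN n (a \ e) (BooleanSubalgebra.sdiff_mem ha he) (Set.sdiff_subset_sdiff_left hac)
  rw [← (hadd n).inter_add_sdiff ha he] at hlt
  linarith [abs_add_le (ν n (a ∩ e)) (ν n (a \ e))]

/-- Run through an enumeration of `B`, each time keeping a half on which `ν` is still unbounded. -/
theorem exists_unboundedBelow_base (hB : (B : Set (Set X)).Countable)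
    (hadd : ∀ n, AdditiveOn B (ν n)) (hunb : ∀ M : ℝ, ∃ n, ∃ a ∈ B, M < |ν n a|) :
    ∃ b : ℕ → Set X, IsUltrafilterBase B b ∧ ∀ k, UnboundedBelow B ν (b k) := by
  obtain ⟨e, he⟩ := hB.exists_eq_range ⟨∅, B.bot_mem⟩
  have hemem : ∀ k, e k ∈ B := fun k => by
    have : e k ∈ Set.range e := ⟨k, rfl⟩
    rwa [← he] at this
  have hstep : ∀ (k : ℕ) (c : {c : Set X // c ∈ B ∧ UnboundedBelow B ν c}),
      ∃ d : {c : Set X // c ∈ B ∧ UnboundedBelow B ν c},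
        d.1 ⊆ c.1 ∧ (d.1 ⊆ e k ∨ Disjoint d.1 (e k)) := by
    rintro k ⟨c, hc, hu⟩
    rcases hu.inter_or_sdiff hadd (hemem k) with h | h
    · exact ⟨⟨c ∩ e k, B.infClosed hc (hemem k), h⟩, Set.inter_subset_left,
        Or.inl Set.inter_subset_right⟩
    · exact ⟨⟨c \ e k, BooleanSubalgebra.sdiff_mem hc (hemem k), h⟩, Set.sdiff_subset,
        Or.inr Set.disjoint_sdiff_left⟩
  choose F hF1 hF2 using hstep
  let b : ℕ → {c : Set X // c ∈ B ∧ UnboundedBelow B ν c} := fun k =>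
    Nat.rec ⟨Set.univ, B.top_mem, fun M => by
      obtain ⟨n, a, ha, h⟩ := hunb M
      exact ⟨n, a, ha, Set.subset_univ a, h⟩⟩ (fun k c => F k c) k
  refine ⟨fun k => (b k).1, ⟨antitone_nat_of_succ_le fun k => hF1 k (b k), fun k => (b k).2.1,
    fun c hc => ?_⟩, fun k => (b k).2.2⟩
  obtain ⟨k, rfl⟩ : c ∈ Set.range e := he ▸ hc
  exact ⟨k + 1, hF2 k (b k)⟩

/-- One step of the gliding hump: a member of `B` of large measure which lies below `b k` and
outside the ultrafilter generated by `b`. -/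
theorem exists_hump (hadd : ∀ n, AdditiveOn B (ν n)) (hbdd : ∀ n, ∃ M, ∀ a ∈ B, |ν n a| ≤ M)
    (hpt : ∀ a ∈ B, ∃ M, ∀ n, |ν n a| ≤ M) {b : ℕ → Set X} (hb : IsUltrafilterBase B b)
    (hunb : ∀ k, UnboundedBelow B ν (b k)) (k : ℕ) (C : ℝ) :
    ∃ (n : ℕ) (a : Set X) (k' : ℕ) (C' : ℝ), a ∈ B ∧ a ⊆ b k ∧ Disjoint a (b k') ∧ C < |ν n a| ∧
      k < k' ∧ (∀ c ∈ B, c ⊆ b k' → (∃ m, Disjoint c (b m)) → |ν n c| ≤ 1) ∧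
      ∀ m, |ν m a| ≤ C' - C - 1 := by
  obtain ⟨n, a, k₁, ha, hak, hd, hC⟩ : ∃ (n : ℕ) (a : Set X) (k₁ : ℕ),
      a ∈ B ∧ a ⊆ b k ∧ Disjoint a (b k₁) ∧ C < |ν n a| := by
    obtain ⟨M, hM⟩ := hpt _ (hb.mem k)
    obtain ⟨n, a, ha, hak, hlt⟩ := hunb k (|C| + M)
    have hM0 : 0 ≤ M := (abs_nonneg _).trans (hM n)
    -- If `a` lies in the ultrafilter, its complement in `b k` is used instead; the extra `M` in the
    -- threshold pays for `ν n (b k)`.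
    obtain ⟨k₁, h | h⟩ := hb.decide a ha
    · refine ⟨n, b k \ a, k₁, BooleanSubalgebra.sdiff_mem (hb.mem k) ha, Set.sdiff_subset,
        Set.disjoint_sdiff_left.mono_right h, ?_⟩
      have h1 := (hadd n).inter_add_sdiff (hb.mem k) ha
      rw [Set.inter_eq_self_of_subset_right hak] at h1
      have h2 : ν n a = ν n (b k) - ν n (b k \ a) := by linarith
      rw [h2] at hlt
      linarith [abs_sub (ν n (b k)) (ν n (b k \ a)), hM n, le_abs_self C]
    · exact ⟨n, a, k₁, ha, hak, h.symm, by linarith [le_abs_self C]⟩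
  obtain ⟨M, hM⟩ := hbdd n
  obtain ⟨v, hv, hpos, hdom, -⟩ := (hadd n).exists_dominating hM
  -- Where the variation `v` is within 1 of its infimum along the base, any set below `b k₂` and
  -- outside the ultrafilter has variation below 1.
  obtain ⟨k₂, hk₂⟩ : ∃ k₂, ∀ m, v (b k₂) < v (b m) + 1 := by
    have hbb : BddBelow (Set.range fun m => v (b m)) := ⟨0, by rintro _ ⟨m, rfl⟩; exact hpos _⟩
    obtain ⟨_, ⟨k₂, rfl⟩, h⟩ := Real.lt_sInf_add_pos (Set.range_nonempty fun m => v (b m)) one_pos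
    exact ⟨k₂, fun m => h.trans_le (by linarith [csInf_le hbb ⟨m, rfl⟩])⟩
  obtain ⟨D, hD⟩ := hpt a ha
  refine ⟨n, a, max (k + 1) (max k₁ k₂), C + 1 + D, ha, hak,
    hd.mono_right (hb.anti (by simp)), hC, by simp, ?_, fun m => by linarith [hD m]⟩
  rintro c hc hck ⟨m, hm⟩
  have hck₂ : c ⊆ b k₂ := hck.trans (hb.anti (by simp))
  have h1 : v c + v (b (max k₂ m)) ≤ v (b k₂) := by
    rw [← hv c hc _ (hb.mem _) (hm.mono_right (hb.anti (by simp)))]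
    exact hv.le_of_subset (fun a _ => hpos a) (B.supClosed hc (hb.mem _)) (hb.mem _)
      (Set.union_subset hck₂ (hb.anti (by simp)))
  linarith [hdom c hc, hk₂ (max k₂ m)]

/-- A sequence of disjoint humps converging to an ultrafilter of `B`. -/
structure Humps (B : BooleanSubalgebra (Set X)) (ν : ℕ → Set X → ℝ) (d a : ℕ → Set X)
    (n : ℕ → ℕ) (C : ℕ → ℝ) : Prop where
  base : IsUltrafilterBase B d
  mem : ∀ j, a j ∈ B
  subset : ∀ j, a j ⊆ d j
  disjoint : ∀ j, Disjoint (a j) (d (j + 1))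
  large : ∀ j, C j < |ν (n j) (a j)|
  tail : ∀ j, ∀ c ∈ B, c ⊆ d (j + 1) → (∃ m, Disjoint c (d m)) → |ν (n j) c| ≤ 1
  nonneg : 0 ≤ C 0
  growth : ∀ j m, |ν m (a j)| ≤ C (j + 1) - C j - 1

theorem exists_humps (hB : (B : Set (Set X)).Countable) (hadd : ∀ n, AdditiveOn B (ν n))
    (hbdd : ∀ n, ∃ M, ∀ a ∈ B, |ν n a| ≤ M) (hpt : ∀ a ∈ B, ∃ M, ∀ n, |ν n a| ≤ M)
    (hunb : ∀ M : ℝ, ∃ n, ∃ a ∈ B, M < |ν n a|) :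
    ∃ d a n C, Humps B ν d a n C := by
  obtain ⟨b, hb, hbu⟩ := exists_unboundedBelow_base hB hadd hunb
  choose N a K D ha hak hd hlarge hlt htail hgrow using exists_hump hadd hbdd hpt hb hbu
  let st : ℕ → ℕ × ℝ := fun j => Nat.rec (0, 0) (fun _ s => (K s.1 s.2, D s.1 s.2)) j
  have hmono : StrictMono fun j => (st j).1 := strictMono_nat_of_lt_succ fun j => hlt _ _
  refine ⟨fun j => b (st j).1, fun j => a (st j).1 (st j).2, fun j => N (st j).1 (st j).2,
    fun j => (st j).2, ⟨hb.anti.comp_monotone hmono.monotone, fun j => hb.mem _, ?_⟩,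
    fun j => ha _ _, fun j => hak _ _, fun j => hd _ _, fun j => hlarge _ _, ?_, le_rfl,
    fun j m => hgrow _ _ m⟩
  · intro c hc
    obtain ⟨k, hk⟩ := hb.decide c hc
    have hsub : b (st k).1 ⊆ b k := hb.anti (hmono.le_apply (x := k))
    exact ⟨k, hk.imp hsub.trans fun h => h.mono_left hsub⟩
  · rintro j c hc hcd ⟨m, hm⟩
    exact htail _ _ c hc hcd ⟨_, hm⟩

namespace Humps

variable {d a : ℕ → Set X} {n : ℕ → ℕ} {C : ℕ → ℝ}

theorem sdiff_succ (h : Humps B ν d a n C) (S : Set ℕ) (j : ℕ) [Decidable (j ∈ S)] :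
    (⋃ i ∈ S, a i) \ d (j + 1) = ((⋃ i ∈ S, a i) \ d j) ∪ (if j ∈ S then a j else ∅) := by
  ext t
  have hanti : t ∈ d (j + 1) → t ∈ d j := fun ht => h.base.anti j.le_succ ht
  have hd : ∀ i, t ∈ a i → i ≤ j → t ∉ d (j + 1) := fun i hi hij ht =>
    Set.disjoint_left.1 (h.disjoint i) hi (h.base.anti (by omega) ht)
  have hs : ∀ i, t ∈ a i → j + 1 ≤ i → t ∈ d (j + 1) := fun i hi hij =>
    h.base.anti hij (h.subset i hi)
  have hs' : ∀ i, t ∈ a i → j ≤ i → t ∈ d j := fun i hi hij =>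
    h.base.anti hij (h.subset i hi)
  split_ifs with hj
  · simp only [Set.mem_sdiff, Set.mem_iUnion, Set.mem_union, exists_prop]
    constructor
    · rintro ⟨⟨i, hi, hti⟩, htd⟩
      by_cases hij : i = j
      · exact Or.inr (hij ▸ hti)
      · refine Or.inl ⟨⟨i, hi, hti⟩, fun htj => ?_⟩
        have hlt : i < j := by
          by_contra hc
          exact htd (hs i hti (by omega))
        exact Set.disjoint_left.1 (h.disjoint i) hti (h.base.anti (by omega : i + 1 ≤ j) htj)
    · rintro (⟨hx, htd⟩ | ht)
      · exact ⟨hx, fun h' => htd (hanti h')⟩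
      · exact ⟨⟨j, hj, ht⟩, hd j ht le_rfl⟩
  · simp only [Set.mem_sdiff, Set.mem_iUnion, Set.union_empty, exists_prop]
    constructor
    · rintro ⟨⟨i, hi, hti⟩, htd⟩
      refine ⟨⟨i, hi, hti⟩, fun htj => ?_⟩
      have hij : i ≠ j := fun hij => hj (hij ▸ hi)
      have hlt : i < j := by
        by_contra hc
        exact htd (hs i hti (by omega))
      exact Set.disjoint_left.1 (h.disjoint i) hti (h.base.anti (by omega : i + 1 ≤ j) htj)
    · rintro ⟨hx, htd⟩
      exact ⟨hx, fun h' => htd (hanti h')⟩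

theorem sdiff_zero (h : Humps B ν d a n C) (S : Set ℕ) : (⋃ i ∈ S, a i) \ d 0 = ∅ := by
  rw [Set.sdiff_eq_empty]
  exact Set.iUnion₂_subset fun i _ => (h.subset i).trans (h.base.anti i.zero_le)

theorem sdiff_mem (h : Humps B ν d a n C) (S : Set ℕ) (k : ℕ) : (⋃ i ∈ S, a i) \ d k ∈ B := by
  classical
  induction k with
  | zero => rw [h.sdiff_zero]; exact B.bot_mem
  | succ k ih =>
    rw [h.sdiff_succ]
    refine B.supClosed ih ?_
    split_ifs
    · exact h.mem k
    · exact B.bot_mem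

theorem disjoint_sdiff (h : Humps B ν d a n C) (S : Set ℕ) (j : ℕ) :
    Disjoint ((⋃ i ∈ S, a i) \ d j) (a j) :=
  Set.disjoint_sdiff_left.mono_right (h.subset j)

/-- `C j` exceeds by `j` the total size of the earlier humps, uniformly in the measure; this surplus
is what the next hump gains over its predecessors. -/
theorem abs_sdiff_le (h : Humps B ν d a n C) (hadd : ∀ n, AdditiveOn B (ν n)) (S : Set ℕ)
    (m j : ℕ) : |ν m ((⋃ i ∈ S, a i) \ d j)| ≤ C j - j := by
  classical
  induction j with
  | zero => simpa [h.sdiff_zero, (hadd m).empty] using h.nonneg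
  | succ j ih =>
    have hg := h.growth j m
    rw [h.sdiff_succ]
    push_cast
    split_ifs
    · rw [hadd m _ (h.sdiff_mem S j) _ (h.mem j) (h.disjoint_sdiff S j)]
      linarith [abs_add_le (ν m ((⋃ i ∈ S, a i) \ d j)) (ν m (a j))]
    · rw [Set.union_empty]
      linarith [abs_nonneg (ν m (a j))]

/-- Three parts contribute: the hump `a j` more than `C j`, the earlier humps at most `C j - j`, and
the later ones at most 1 by `tail`. -/
theorem le_abs_sdiff (h : Humps B ν d a n C) (hadd : ∀ n, AdditiveOn B (ν n)) {S : Set ℕ}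
    {j k : ℕ} (hj : j ∈ S) (hjk : j < k) :
    (j : ℝ) - 1 ≤ |ν (n j) ((⋃ i ∈ S, a i) \ d k)| := by
  classical
  set x := ⋃ i ∈ S, a i with hx
  have hcap : (x \ d k) ∩ d (j + 1) ∈ B := B.infClosed (h.sdiff_mem S k) (h.base.mem _)
  have h1 := (hadd (n j)).inter_add_sdiff (h.sdiff_mem S k) (h.base.mem (j + 1))
  have h2 : (x \ d k) \ d (j + 1) = (x \ d j) ∪ a j := by
    have := h.sdiff_succ S j
    rw [if_pos hj] at this
    rw [← this, Set.sdiff_sdiff, Set.union_eq_self_of_subset_left (h.base.anti hjk)]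
  rw [← hx, h2, hadd (n j) _ (h.sdiff_mem S j) _ (h.mem j) (h.disjoint_sdiff S j)] at h1
  have h3 := h.tail j _ hcap Set.inter_subset_right
    ⟨k, Set.disjoint_sdiff_left.mono_left Set.inter_subset_left⟩
  have h4 := h.abs_sdiff_le hadd S (n j) j
  have h5 := h.large j
  rw [← h1]
  rw [← hx] at h4
  set p := ν (n j) (x \ d k ∩ d (j + 1))
  set q := ν (n j) (x \ d j)
  set r := ν (n j) (a j)
  have h6 : |r| ≤ |p + (q + r)| + |p| + |q| := by
    have : r = (p + (q + r)) - p - q := by ring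
    calc |r| = |(p + (q + r)) - p - q| := by rw [← this]
      _ ≤ |(p + (q + r)) - p| + |q| := abs_sub _ _
      _ ≤ _ := by gcongr; exact abs_sub _ _
  linarith

theorem sdiff_large (h : Humps B ν d a n C) (hadd : ∀ n, AdditiveOn B (ν n)) {S : Set ℕ}
    (hS : ∀ m, ∃ j ∈ S, m < j) (M : ℝ) :
    ∃ m, ∃ᶠ k in atTop, M < |ν m ((⋃ i ∈ S, a i) \ d k)| := by
  obtain ⟨N, hN⟩ := exists_nat_gt (M + 1)
  obtain ⟨j, hj, hNj⟩ := hS N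
  have hNj' : (N : ℝ) < j := by exact_mod_cast hNj
  refine ⟨n j, Eventually.frequently ?_⟩
  filter_upwards [eventually_gt_atTop j] with k hk
  linarith [h.le_abs_sdiff hadd hj hk]

end Humps

/-- Every pointwise bounded, but not uniformly bounded sequence of measures on a countable
algebra of sets is destroyed by a suitable set. -/
theorem exists_destroys (hB : (B : Set (Set X)).Countable) (hadd : ∀ n, AdditiveOn B (ν n))
    (hbdd : ∀ n, ∃ M, ∀ a ∈ B, |ν n a| ≤ M) (hpt : ∀ a ∈ B, ∃ M, ∀ n, |ν n a| ≤ M)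
    (hunb : ∀ M : ℝ, ∃ n, ∃ a ∈ B, M < |ν n a|) :
    ∃ x b, Destroys B ν x b := by
  obtain ⟨d, a, n, C, h⟩ := exists_humps hB hadd hbdd hpt hunb
  -- If the union of all humps is large from outside, it works. Otherwise the even humps do: for odd
  -- `j`, `ν (n j)` is large on the odd humps but bounded on the whole, so it is large on the
  -- complementary part, the even humps together with `d k`.
  by_cases hall : ∀ M : ℝ, ∃ m, ∃ᶠ k in atTop, M < |ν m ((⋃ i ∈ Set.univ, a i) ∪ d k)|
  · exact ⟨_, d, h.base, h.sdiff_mem Set.univ,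
      h.sdiff_large hadd fun m => ⟨m + 1, trivial, m.lt_succ_self⟩, hall⟩
  push Not at hall
  obtain ⟨D, hD⟩ := hall
  refine ⟨⋃ i ∈ {i | Even i}, a i, d, h.base, h.sdiff_mem _,
    h.sdiff_large hadd fun m => ⟨2 * (m + 1), even_two_mul _, by omega⟩, fun M => ?_⟩
  obtain ⟨N, hN⟩ := exists_nat_gt (M + D + 1)
  set j := 2 * N + 1 with hj
  have hjN : (N : ℝ) ≤ j := by exact_mod_cast (by omega : N ≤ j)
  refine ⟨n j, Eventually.frequently ?_⟩
  filter_upwards [hD (n j), eventually_gt_atTop j] with k hk hjk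
  have hodd : (j : ℝ) - 1 ≤ |ν (n j) ((⋃ i ∈ {i | ¬ Even i}, a i) \ d k)| :=
    h.le_abs_sdiff hadd (by simp [hj]) hjk
  have hdisj : Disjoint ((⋃ i ∈ {i | Even i}, a i) ∪ d k)
      ((⋃ i ∈ {i | ¬ Even i}, a i) \ d k) := by
    rw [Set.disjoint_union_left]
    refine ⟨?_, Set.disjoint_sdiff_right⟩
    rw [Set.disjoint_left]
    intro t ht ht'
    simp only [Set.mem_sdiff, Set.mem_iUnion, Set.mem_ofPred_eq, exists_prop] at ht ht'
    obtain ⟨i, hi, hti⟩ := ht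
    obtain ⟨⟨i', hi', hti'⟩, -⟩ := ht'
    rcases lt_trichotomy i i' with hlt | rfl | hlt
    · exact Set.disjoint_left.1 (h.disjoint i) hti (h.base.anti hlt (h.subset i' hti'))
    · exact hi' hi
    · exact Set.disjoint_left.1 (h.disjoint i') hti' (h.base.anti hlt (h.subset i hti))
  have hunion : (⋃ i ∈ Set.univ, a i) ∪ d k = ((⋃ i ∈ {i | Even i}, a i) ∪ d k) ∪
      ((⋃ i ∈ {i | ¬ Even i}, a i) \ d k) := by
    rw [Set.union_assoc, Set.union_sdiff_self, Set.union_left_comm,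
      ← Set.biUnion_union, ← Set.compl_ofPred, Set.union_compl_self, Set.union_comm]
  rw [hunion, hadd (n j) _ (union_mem_of_sdiff_mem (h.base.mem k) (h.sdiff_mem _ k)) _
    (h.sdiff_mem _ k) hdisj] at hk
  set p := ν (n j) ((⋃ i ∈ {i | Even i}, a i) ∪ d k)
  set q := ν (n j) ((⋃ i ∈ {i | ¬ Even i}, a i) \ d k)
  have : |q| ≤ |p + q| + |p| := by
    calc |q| = |(p + q) - p| := by rw [add_sub_cancel_left]
      _ ≤ _ := abs_sub _ _
  change M < |p|
  linarith

end Destroys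

/-! ### Stone spaces and Maharam type -/

namespace StoneSpace

variable {A : Type*} [BooleanAlgebra A]

/-- The basic clopen set of all ultrafilters containing `a`. -/
def basicClopen (a : A) : Set (StoneSpace A) := {x | a ∈ x.1}

theorem compl_mem_iff (x : StoneSpace A) {a : A} : aᶜ ∈ x.1 ↔ a ∉ x.1 := by
  refine ⟨fun h h' => x.2.1 ?_, (x.2.2 a).resolve_left⟩
  have h0 : a ⊓ aᶜ ∈ x.1 := Order.PFilter.inf_mem h' h
  rwa [inf_compl_eq_bot] at h0

theorem basicClopen_compl (a : A) : basicClopen aᶜ = (basicClopen a)ᶜ :=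
  Set.ext fun x => x.compl_mem_iff

theorem basicClopen_inf (a b : A) : basicClopen (a ⊓ b) = basicClopen a ∩ basicClopen b :=
  Set.ext fun _ => Order.PFilter.inf_mem_iff

theorem basicClopen_sup (a b : A) : basicClopen (a ⊔ b) = basicClopen a ∪ basicClopen b := by
  rw [← compl_inj_iff, ← basicClopen_compl, compl_sup, basicClopen_inf, basicClopen_compl,
    basicClopen_compl, Set.compl_union]

theorem basicClopen_bot : basicClopen (⊥ : A) = ∅ :=
  Set.eq_empty_of_forall_notMem fun x => x.2.1

theorem basicClopen_symmDiff (a b : A) :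
    basicClopen (symmDiff a b) = symmDiff (basicClopen a) (basicClopen b) := by
  simp only [symmDiff, sdiff_eq, basicClopen_sup, basicClopen_inf, basicClopen_compl]
  rfl

theorem isOpen_basicClopen (a : A) : IsOpen (basicClopen a) :=
  TopologicalSpace.isOpen_generateFrom_of_mem ⟨a, rfl⟩

theorem measurableSet_basicClopen (a : A) : MeasurableSet (basicClopen a) :=
  (isOpen_basicClopen a).measurableSet

theorem exists_basicClopen_subset {U : Set (StoneSpace A)} (hU : IsOpen U) {x : StoneSpace A}
    (hx : x ∈ U) : ∃ a, x ∈ basicClopen a ∧ basicClopen a ⊆ U := by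
  induction hU with
  | basic s hs =>
    obtain ⟨a, rfl⟩ := hs
    exact ⟨a, hx, subset_rfl⟩
  | univ => exact ⟨⊤, Order.PFilter.top_mem, Set.subset_univ _⟩
  | inter s t _ _ hs ht =>
    obtain ⟨a, ha, has⟩ := hs hx.1
    obtain ⟨b, hb, hbt⟩ := ht hx.2
    refine ⟨a ⊓ b, ?_, ?_⟩ <;> rw [basicClopen_inf]
    · exact ⟨ha, hb⟩
    · exact Set.inter_subset_inter has hbt
  | sUnion S _ ih =>
    obtain ⟨s, hs, hxs⟩ := hx
    obtain ⟨a, ha, has⟩ := ih s hs hxs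
    exact ⟨a, ha, has.trans (Set.subset_sUnion_of_mem hs)⟩

theorem exists_basicClopen_between {K U : Set (StoneSpace A)} (hK : IsCompact K) (hU : IsOpen U)
    (hKU : K ⊆ U) : ∃ a, K ⊆ basicClopen a ∧ basicClopen a ⊆ U := by
  refine hK.induction_on (p := fun s => ∃ a, s ⊆ basicClopen a ∧ basicClopen a ⊆ U)
    ⟨⊥, Set.empty_subset _, by simp [basicClopen_bot]⟩ ?_ ?_ fun x hx => ?_
  · rintro s t hst ⟨a, ha, haU⟩
    exact ⟨a, hst.trans ha, haU⟩
  · rintro s t ⟨a, ha, haU⟩ ⟨b, hb, hbU⟩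
    refine ⟨a ⊔ b, ?_, ?_⟩ <;> rw [basicClopen_sup]
    · exact Set.union_subset_union ha hb
    · exact Set.union_subset haU hbU
  · obtain ⟨a, ha, haU⟩ := exists_basicClopen_subset hU (hKU hx)
    exact ⟨_, mem_nhdsWithin_of_mem_nhds ((isOpen_basicClopen a).mem_nhds ha), a, subset_rfl, haU⟩

instance instT2Space : T2Space (StoneSpace A) := by
  refine ⟨fun x y hxy => ?_⟩
  have key : ∀ x y : StoneSpace A, (∃ a, a ∈ x.1 ∧ a ∉ y.1) →
      ∃ u v : Set (StoneSpace A), IsOpen u ∧ IsOpen v ∧ x ∈ u ∧ y ∈ v ∧ Disjoint u v := by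
    rintro x y ⟨a, hx, hy⟩
    refine ⟨basicClopen a, basicClopen aᶜ, isOpen_basicClopen a, isOpen_basicClopen aᶜ, hx,
      y.compl_mem_iff.2 hy, ?_⟩
    rw [basicClopen_compl]
    exact disjoint_compl_right
  refine key x y ?_
  by_contra! hsub
  refine hxy (Subtype.ext (SetLike.ext fun a => ⟨hsub a, fun ha => ?_⟩))
  by_contra hx
  exact y.compl_mem_iff.1 (hsub _ (x.compl_mem_iff.2 hx)) ha

variable {μ : Measure (StoneSpace A)}

/-- Regularity squeezes `B` between a compact and an open set, and a basic clopen set fits between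
these. -/
theorem exists_basicClopen_symmDiff_lt [IsProbabilityMeasure μ] [μ.Regular]
    {B : Set (StoneSpace A)} (hB : MeasurableSet B) {ε : ENNReal} (hε : 0 < ε) :
    ∃ a, μ (symmDiff B (basicClopen a)) < ε := by
  have hε2 : ε / 2 ≠ 0 := (ENNReal.half_pos hε.ne').ne'
  obtain ⟨U, hBU, hU, -, hμU⟩ := hB.exists_isOpen_sdiff_lt (measure_ne_top μ B) hε2
  obtain ⟨K, hKB, hK, hμK⟩ := hB.exists_isCompact_sdiff_lt (measure_ne_top μ B) hε2
  obtain ⟨a, hKa, haU⟩ := exists_basicClopen_between hK hU (hKB.trans hBU)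
  refine ⟨a, ?_⟩
  calc μ (symmDiff B (basicClopen a)) ≤ μ (B \ K ∪ U \ B) :=
        measure_mono (Set.union_subset_union (Set.sdiff_subset_sdiff_right hKa)
          (Set.sdiff_subset_sdiff_left haU))
    _ ≤ μ (B \ K) + μ (U \ B) := measure_union_le _ _
    _ < ε / 2 + ε / 2 := ENNReal.add_lt_add hμK hμU
    _ = ε := ENNReal.add_halves ε

theorem maharamType_le_aleph0 [IsProbabilityMeasure μ] [μ.Regular] {S : Set A}
    (hS : S.Countable) (hd : ∀ a, ∀ ε : ENNReal, 0 < ε →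
      ∃ b ∈ S, μ (basicClopen (symmDiff a b)) < ε) :
    maharamType μ ≤ Cardinal.aleph0 := by
  have hC : (basicClopen '' S).Countable := hS.image _
  refine le_trans (b := Cardinal.mk (basicClopen '' S)) (csInf_le'
    ⟨basicClopen '' S, ?_, fun B hB ε hε => ?_, rfl⟩) (Cardinal.le_aleph0_iff_set_countable.2 hC)
  · rintro _ ⟨a, -, rfl⟩
    exact measurableSet_basicClopen a
  · have hε2 : 0 < ε / 2 := ENNReal.half_pos hε.ne'
    obtain ⟨a, ha⟩ := exists_basicClopen_symmDiff_lt (μ := μ) hB hε2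
    obtain ⟨b, hb, hab⟩ := hd a _ hε2
    refine ⟨_, ⟨b, hb, rfl⟩, ?_⟩
    rw [basicClopen_symmDiff] at hab
    calc μ (symmDiff B (basicClopen b)) ≤
          μ (symmDiff B (basicClopen a)) + μ (symmDiff (basicClopen a) (basicClopen b)) :=
          measure_symmDiff_le _ _ _
      _ < ε / 2 + ε / 2 := ENNReal.add_lt_add ha hab
      _ = ε := ENNReal.add_halves ε

end StoneSpace

/-! ### Countable ordinals and generated algebras -/

theorem BooleanSubalgebra.countable_closure {α : Type*} [BooleanAlgebra α] {s : Set α}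
    (hs : s.Countable) : (closure s : Set α).Countable := by
  let T : ℕ → Set α := fun n =>
    Nat.rec (s ∪ {⊥}) (fun _ t => t ∪ (compl '' t ∪ Set.image2 (· ⊔ ·) t t)) n
  have hT : ∀ n, (T n).Countable := by
    intro n
    induction n with
    | zero => exact hs.union (Set.countable_singleton _)
    | succ n ih => exact ih.union ((ih.image _).union (ih.image2 ih _))
  have hmono : Monotone T := monotone_nat_of_le_succ fun n => Set.subset_union_left
  have hcompl : ∀ {n a}, a ∈ T n → aᶜ ∈ T (n + 1) := fun h =>
    Or.inr (Or.inl ⟨_, h, rfl⟩)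
  have hsup : ∀ {a b}, a ∈ ⋃ n, T n → b ∈ ⋃ n, T n → a ⊔ b ∈ ⋃ n, T n := by
    intro a b ha hb
    obtain ⟨m, hm⟩ := Set.mem_iUnion.1 ha
    obtain ⟨n, hn⟩ := Set.mem_iUnion.1 hb
    exact Set.mem_iUnion.2 ⟨max m n + 1, Or.inr (Or.inr
      ⟨a, hmono (le_max_left m n) hm, b, hmono (le_max_right m n) hn, rfl⟩)⟩
  refine (Set.countable_iUnion hT).mono fun a ha => ?_
  induction ha using closure_bot_sup_induction with
  | mem x hx => exact Set.mem_iUnion.2 ⟨0, Or.inl hx⟩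
  | bot => exact Set.mem_iUnion.2 ⟨0, Or.inr rfl⟩
  | sup x _ y _ hx hy => exact hsup hx hy
  | compl x _ hx =>
    obtain ⟨n, hn⟩ := Set.mem_iUnion.1 hx
    exact Set.mem_iUnion.2 ⟨n + 1, hcompl hn⟩

/-- The linear order of all countable ordinals. -/
abbrev CountableOrdinal : Type 1 := Set.Iio (Ordinal.omega.{0} 1)

namespace CountableOrdinal

theorem exists_forall_le (f : ℕ → CountableOrdinal) : ∃ α, ∀ n, f n ≤ α := by
  refine ⟨⟨⨆ n, (f n).1, Ordinal.iSup_lt_omega_one fun n => (f n).2⟩, fun n => ?_⟩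
  exact Ordinal.le_iSup (fun n => (f n).1) n

theorem exists_gt (α : CountableOrdinal) : ∃ β, α < β :=
  ⟨⟨Order.succ α.1, (Cardinal.isSuccLimit_omega 1).succ_lt α.2⟩, Order.lt_succ α.1⟩

theorem countable_Iio (α : CountableOrdinal) : (Set.Iio α).Countable := by
  have h : (Set.Iio α.1).Countable := by
    rw [← Cardinal.le_aleph0_iff_set_countable, Cardinal.mk_Iio_ordinal, Cardinal.lift_le_aleph0]
    have h1 : α.1.card < Cardinal.aleph 1 := Cardinal.lt_ord.1 (by
      rw [Cardinal.ord_aleph]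
      exact α.2)
    rwa [← Order.lt_succ_iff, Cardinal.succ_aleph0]
  exact (h.preimage Subtype.val_injective).mono fun β hβ => hβ

theorem countable_Iic (α : CountableOrdinal) : (Set.Iic α).Countable := by
  rw [← Set.Iio_insert]
  exact (countable_Iio α).insert _

end CountableOrdinal

/-- The algebra of sets of naturals generated by the singletons and the sets `x i`, `i ∈ s`. -/
def generatedAlgebra {ι : Type*} (x : ι → Set ℕ) (s : Set ι) : BooleanSubalgebra (Set ℕ) :=
  BooleanSubalgebra.closure (Set.range (fun n : ℕ => ({n} : Set ℕ)) ∪ x '' s)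

section generatedAlgebra

variable {ι : Type*} {x y : ι → Set ℕ} {s t : Set ι}

theorem generatedAlgebra_mono (h : s ⊆ t) : generatedAlgebra x s ≤ generatedAlgebra x t :=
  BooleanSubalgebra.closure_mono (Set.union_subset_union_right _ (Set.image_mono h))

theorem generatedAlgebra_congr (h : Set.EqOn x y s) :
    generatedAlgebra x s = generatedAlgebra y s := by
  rw [generatedAlgebra, h.image_eq, generatedAlgebra]

theorem mem_generatedAlgebra {i : ι} (hi : i ∈ s) : x i ∈ generatedAlgebra x s :=
  BooleanSubalgebra.subset_closure (Or.inr ⟨i, hi, rfl⟩)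

theorem singleton_mem_generatedAlgebra (n : ℕ) : {n} ∈ generatedAlgebra x s :=
  BooleanSubalgebra.subset_closure (Or.inl ⟨n, rfl⟩)

theorem countable_generatedAlgebra (hs : s.Countable) :
    (generatedAlgebra x s : Set (Set ℕ)).Countable :=
  BooleanSubalgebra.countable_closure ((Set.countable_range _).union (hs.image _))

/-- A member of the algebra involves only finitely many generators; `s` must be nonempty to provide
a stage for the singletons. -/
theorem exists_mem_generatedAlgebra_Iic [LinearOrder ι] (hs : s.Nonempty) {a : Set ℕ}
    (ha : a ∈ generatedAlgebra x s) : ∃ β ∈ s, a ∈ generatedAlgebra x (Set.Iic β) := by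
  obtain ⟨β₀, hβ₀⟩ := hs
  induction ha using BooleanSubalgebra.closure_bot_sup_induction with
  | mem a ha =>
    obtain ⟨n, rfl⟩ | ⟨i, hi, rfl⟩ := ha
    · exact ⟨β₀, hβ₀, singleton_mem_generatedAlgebra n⟩
    · exact ⟨i, hi, mem_generatedAlgebra (Set.mem_Iic.2 le_rfl)⟩
  | bot => exact ⟨β₀, hβ₀, BooleanSubalgebra.bot_mem⟩
  | sup a _ b _ ha hb =>
    obtain ⟨β, hβ, ha⟩ := ha
    obtain ⟨γ, hγ, hb⟩ := hb
    rcases le_total β γ with h | h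
    · exact ⟨γ, hγ, BooleanSubalgebra.sup_mem
        (generatedAlgebra_mono (Set.Iic_subset_Iic.2 h) ha) hb⟩
    · exact ⟨β, hβ, BooleanSubalgebra.sup_mem ha
        (generatedAlgebra_mono (Set.Iic_subset_Iic.2 h) hb)⟩
  | compl a _ ha =>
    obtain ⟨β, hβ, ha⟩ := ha
    exact ⟨β, hβ, BooleanSubalgebra.compl_mem ha⟩

end generatedAlgebra

/-! ### Coding sequences of set functions -/

open Classical in
/-- An enumeration of a countable algebra of sets. -/
noncomputable def enumeration (B : BooleanSubalgebra (Set ℕ)) : ℕ → Set ℕ :=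
  if h : (B : Set (Set ℕ)).Countable then (h.exists_eq_range ⟨∅, B.bot_mem⟩).choose
  else fun _ => ∅

theorem range_enumeration {B : BooleanSubalgebra (Set ℕ)} (h : (B : Set (Set ℕ)).Countable) :
    Set.range (enumeration B) = B := by
  rw [enumeration, dif_pos h]
  exact (h.exists_eq_range ⟨∅, B.bot_mem⟩).choose_spec.symm

open Classical in
/-- The code of a sequence of set functions on an increasing union of countable algebras: the
bits at `β` record which rationals lie above the values on the members of the algebra
generated up to `β`. -/
noncomputable def measureCode {ι : Type*} [Preorder ι] (x : ι → Set ℕ) (ν : ℕ → Set ℕ → ℝ)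
    (m : ℕ) (β : ι) : Bool :=
  let c := (Denumerable.eqv (ℕ × ℚ × ℕ)).symm m
  decide (ν c.1 (enumeration (generatedAlgebra x (Set.Iic β)) c.2.2) < c.2.1)

/-- The bits at `β` use only generators up to `β`; this lets the code enter a recursion that defines
the generators. -/
theorem measureCode_congr {ι : Type*} [Preorder ι] {x y : ι → Set ℕ} {β : ι}
    (h : Set.EqOn x y (Set.Iic β)) (ν : ℕ → Set ℕ → ℝ) (m : ℕ) :
    measureCode x ν m β = measureCode y ν m β := by
  rw [measureCode, measureCode, generatedAlgebra_congr h]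

theorem eq_of_measureCode_eq {x : CountableOrdinal → Set ℕ} {ν ν' : ℕ → Set ℕ → ℝ}
    {α : CountableOrdinal} (hα : (Set.Iio α).Nonempty)
    (h : ∀ m, ∀ β < α, measureCode x ν m β = measureCode x ν' m β) (n : ℕ) {a : Set ℕ}
    (ha : a ∈ generatedAlgebra x (Set.Iio α)) : ν n a = ν' n a := by
  obtain ⟨β, hβ, ha⟩ := exists_mem_generatedAlgebra_Iic hα ha
  have hr := range_enumeration (countable_generatedAlgebra (x := x) β.countable_Iic)
  obtain ⟨k, rfl⟩ : a ∈ Set.range (enumeration (generatedAlgebra x (Set.Iic β))) := by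
    rw [hr]; exact ha
  refine eq_of_forall_lt_rat_iff_lt fun q => ?_
  have := h (Denumerable.eqv _ (n, q, k)) β hβ
  simpa only [measureCode, Equiv.symm_apply_apply, decide_eq_decide] using this

theorem Destroys.congr {X : Type*} {B : BooleanSubalgebra (Set X)} {ν ν' : ℕ → Set X → ℝ}
    {x : Set X} {b : ℕ → Set X} (h : Destroys B ν x b) (hν : ∀ n, ∀ a ∈ B, ν n a = ν' n a) :
    Destroys B ν' x b where
  base := h.base
  sdiff_mem := h.sdiff_mem
  sdiff_large C := by
    obtain ⟨n, hn⟩ := h.sdiff_large C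
    exact ⟨n, hn.mono fun k hk => by rwa [← hν n _ (h.sdiff_mem k)]⟩
  union_large C := by
    obtain ⟨n, hn⟩ := h.union_large C
    exact ⟨n, hn.mono fun k hk => by
      rwa [← hν n _ (union_mem_of_sdiff_mem (h.base.mem k) (h.sdiff_mem k))]⟩

/-! ### The recursive choice of generators -/

section construction

/-- A family of guesses as in the Diamond Principle. -/
abbrev GuessFamily : Type 1 :=
  (α : CountableOrdinal) → Ordinal.omega0 ≤ α.1 → ℕ → (Set.Iio α → Bool)

/-- The set `z` destroys a sequence of measures on the algebra generated by the sets `y β`,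
`β < α`, whose code is guessed at `α`. -/
def DestroysGuess (f : GuessFamily) (α : CountableOrdinal) (y : CountableOrdinal → Set ℕ)
    (z : Set ℕ) : Prop :=
  ∃ (hα : Ordinal.omega0 ≤ α.1) (ν : ℕ → Set ℕ → ℝ) (b : ℕ → Set ℕ),
    (∀ m, ∀ β : Set.Iio α, measureCode y ν m β.1 = f α hα m β) ∧
      Destroys (generatedAlgebra y (Set.Iio α)) ν z b

theorem DestroysGuess.congr {f : GuessFamily} {α : CountableOrdinal}
    {y y' : CountableOrdinal → Set ℕ} {z : Set ℕ} (hy : Set.EqOn y y' (Set.Iio α))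
    (h : DestroysGuess f α y z) : DestroysGuess f α y' z := by
  obtain ⟨hα, ν, b, hν, hd⟩ := h
  refine ⟨hα, ν, b, fun m β => ?_, generatedAlgebra_congr hy ▸ hd⟩
  rw [← hν m β]
  exact (measureCode_congr (hy.mono fun γ hγ => lt_of_le_of_lt hγ β.2) ν m).symm

open Classical in
/-- A set destroying the measures guessed at `α`, if there is one. -/
noncomputable def nextSet (f : GuessFamily) (α : CountableOrdinal)
    (y : CountableOrdinal → Set ℕ) : Set ℕ :=
  if h : ∃ z, DestroysGuess f α y z then h.choose else ∅

open Classical in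
theorem exists_generators (f : GuessFamily) : ∃ x : CountableOrdinal → Set ℕ, ∀ α,
    (x α = ∅ ∨ DestroysGuess f α x (x α)) ∧
      ((∃ z, DestroysGuess f α x z) → DestroysGuess f α x (x α)) := by
  -- The values from `α` on are filled with `∅`; `DestroysGuess f α` never looks at them.
  let x : CountableOrdinal → Set ℕ := WellFoundedLT.fix fun α ih =>
    nextSet f α fun β => if h : β < α then ih β h else ∅
  have hx : ∀ α, x α = nextSet f α fun β => if β < α then x β else ∅ := fun α => by
    simp only [x]
    rw [WellFoundedLT.fix_eq]
    simp only [dite_eq_ite]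
  have heq : ∀ α, Set.EqOn (fun β => if β < α then x β else ∅) x (Set.Iio α) :=
    fun α β hβ => if_pos hβ
  have key : ∀ α, (∃ z, DestroysGuess f α x z) → DestroysGuess f α x (x α) := by
    rintro α ⟨z, hz⟩
    have h : ∃ z, DestroysGuess f α (fun β => if β < α then x β else ∅) z :=
      ⟨z, hz.congr (heq α).symm⟩
    have h' := h.choose_spec.congr (heq α)
    rwa [hx α, nextSet, dif_pos h]
  refine ⟨x, fun α => ⟨?_, key α⟩⟩
  by_cases h : ∃ z, DestroysGuess f α x z
  · exact Or.inr (key α h)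
  · refine Or.inl ?_
    rw [hx α, nextSet, dif_neg]
    rintro ⟨z, hz⟩
    exact h ⟨z, hz.congr (heq α)⟩

end construction

/-! ### Stabilization of the energy and its consequences -/

section stabilization

variable {x : CountableOrdinal → Set ℕ} {l : Set ℕ → ℝ}

/-- Countably many stages bring the energy arbitrarily near its infimum, and they have a common
upper bound below `ω₁`; monotonicity does the rest. -/
theorem exists_energy_stable (x : CountableOrdinal → Set ℕ) (l : Set ℕ → ℝ) :
    ∃ α₀, ∀ α ≥ α₀, ∀ β, energy (generatedAlgebra x (Set.Iio α)) l ≤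
      energy (generatedAlgebra x (Set.Iio β)) l := by
  set E : CountableOrdinal → ℝ := fun α => energy (generatedAlgebra x (Set.Iio α)) l with hE
  have hbb : BddBelow (Set.range E) := ⟨0, by rintro _ ⟨α, rfl⟩; exact energy_nonneg⟩
  have hne : (Set.range E).Nonempty :=
    ⟨_, ⟨0, Ordinal.omega_pos 1⟩, rfl⟩
  have hex : ∀ n : ℕ, ∃ β, E β < sInf (Set.range E) + 1 / ((n : ℝ) + 1) := fun n => by
    obtain ⟨_, ⟨β, rfl⟩, h⟩ := Real.lt_sInf_add_pos hne (Nat.one_div_pos_of_nat (n := n))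
    exact ⟨β, h⟩
  choose β hβ using hex
  obtain ⟨α₀, hα₀⟩ := CountableOrdinal.exists_forall_le β
  refine ⟨α₀, fun α hα γ => ?_⟩
  refine le_trans (b := sInf (Set.range E)) ?_ (csInf_le hbb ⟨γ, rfl⟩)
  refine le_of_forall_pos_lt_add fun ε hε => ?_
  obtain ⟨n, hn⟩ := exists_nat_one_div_lt hε
  calc E α ≤ E (β n) :=
        energy_anti (generatedAlgebra_mono (Set.Iio_subset_Iio ((hα₀ n).trans hα)))
    _ < _ := hβ n
    _ < _ := by gcongr

/-- From some stage on, adjoining the next generator does not split the mass of an ultrafilter. -/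
theorem exists_forall_not_split (hl : AdditiveOn (generatedAlgebra x Set.univ) l)
    (hpos : ∀ a ∈ generatedAlgebra x Set.univ, 0 ≤ l a) :
    ∃ α₀, ∀ α ≥ α₀, ∀ b, IsUltrafilterBase (generatedAlgebra x (Set.Iio α)) b →
      (∀ ε > 0, ∀ᶠ k in atTop, l (b k ∩ x α) < ε) ∨
        (∀ ε > 0, ∀ᶠ k in atTop, l (b k \ x α) < ε) := by
  obtain ⟨α₀, h⟩ := exists_energy_stable x l
  refine ⟨α₀, fun α hα b hb => ?_⟩
  obtain ⟨β, hβ⟩ := α.exists_gt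
  have hle := generatedAlgebra_mono (x := x) (Set.subset_univ (Set.Iio β))
  exact tendsto_inter_or_tendsto_sdiff
    (generatedAlgebra_mono (Set.Iio_subset_Iio hβ.le)) (mem_generatedAlgebra hβ)
    (hl.mono hle) (fun a ha => hpos a (hle ha)) hb (h α hα β)

/-- Some countable stage is dense in the whole algebra for the pseudometric of `l`. -/
theorem exists_dense_stage
    (hx : ∀ α, x α = ∅ ∨ ∃ ν b, Destroys (generatedAlgebra x (Set.Iio α)) ν (x α) b)
    (hl : AdditiveOn (generatedAlgebra x Set.univ) l)
    (hpos : ∀ a ∈ generatedAlgebra x Set.univ, 0 ≤ l a) :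
    ∃ α₀, ∀ a ∈ generatedAlgebra x Set.univ, ∀ ε > 0,
      ∃ b ∈ generatedAlgebra x (Set.Iio α₀), l (symmDiff a b) < ε := by
  obtain ⟨α₀, hα₀⟩ := exists_forall_not_split hl hpos
  refine ⟨α₀, ?_⟩
  set A := generatedAlgebra x Set.univ with hA
  set B := generatedAlgebra x (Set.Iio α₀) with hBdef
  have hsub : ∀ s, generatedAlgebra x s ≤ A := fun s => generatedAlgebra_mono (Set.subset_univ s)
  have hBA : B ≤ A := hsub _
  have hsymm : ∀ {a b}, a ∈ A → b ∈ A → symmDiff a b ∈ A := fun ha hb =>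
    A.supClosed (BooleanSubalgebra.sdiff_mem ha hb) (BooleanSubalgebra.sdiff_mem hb ha)
  let P : Set ℕ → Prop := fun a => ∀ ε > 0, ∃ b ∈ B, l (symmDiff a b) < ε
  have hPB : ∀ a ∈ B, P a := fun a ha ε hε => ⟨a, ha, by simpa [hl.empty] using hε⟩
  have hPcl : ∀ s : Set CountableOrdinal, (∀ i ∈ s, P (x i)) →
      ∀ a ∈ generatedAlgebra x s, P a := by
    intro s hs a ha
    induction ha using BooleanSubalgebra.closure_bot_sup_induction with
    | mem a ha =>
      obtain ⟨n, rfl⟩ | ⟨i, hi, rfl⟩ := ha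
      · exact hPB _ (singleton_mem_generatedAlgebra n)
      · exact hs i hi
    | bot => exact hPB _ BooleanSubalgebra.bot_mem
    | sup a ha b hb hPa hPb =>
      intro ε hε
      obtain ⟨c, hc, hac⟩ := hPa (ε / 2) (half_pos hε)
      obtain ⟨d, hd, hbd⟩ := hPb (ε / 2) (half_pos hε)
      have haA := hsub s ha
      have hbA := hsub s hb
      refine ⟨c ⊔ d, B.supClosed hc hd, ?_⟩
      have h1 : l (symmDiff (a ⊔ b) (c ⊔ d)) ≤ l (symmDiff a c ∪ symmDiff b d) :=
        hl.le_of_subset hpos (hsymm (A.supClosed haA hbA) (A.supClosed (hBA hc) (hBA hd)))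
          (A.supClosed (hsymm haA (hBA hc)) (hsymm hbA (hBA hd)))
          Set.union_symmDiff_union_subset
      have h2 := hl.union_le hpos (hsymm haA (hBA hc)) (hsymm hbA (hBA hd))
      linarith
    | compl a ha hPa =>
      intro ε hε
      obtain ⟨c, hc, hac⟩ := hPa ε hε
      exact ⟨cᶜ, BooleanSubalgebra.compl_mem hc, by rwa [compl_symmDiff_compl]⟩
  have hPx : ∀ γ, P (x γ) := by
    intro γ
    induction γ using WellFoundedLT.induction with
    | ind γ ih =>
    have hPγ := hPcl (Set.Iio γ) ih
    rcases lt_or_ge γ α₀ with hlt | hge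
    · exact hPB _ (mem_generatedAlgebra hlt)
    rcases hx γ with h0 | ⟨ν, b, hd⟩
    · rw [h0]; exact hPB _ BooleanSubalgebra.bot_mem
    have hxA : x γ ∈ A := mem_generatedAlgebra trivial
    have hbA : ∀ k, b k ∈ A := fun k => hsub _ (hd.base.mem k)
    -- The errors of `x γ \ b k` and `x γ ∪ b k` are exactly `b k ∩ x γ` and `b k \ x γ`, one of
    -- which has small mass.
    have happrox : ∀ ε > 0, ∃ y ∈ generatedAlgebra x (Set.Iio γ), l (symmDiff (x γ) y) < ε := by
      intro ε hε
      rcases hα₀ γ hge b hd.base with h | h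
      · obtain ⟨k, hk⟩ := (h ε hε).exists
        refine ⟨_, hd.sdiff_mem k, ?_⟩
        convert hk using 2
        ext t
        simp [Set.mem_symmDiff]
        tauto
      · obtain ⟨k, hk⟩ := (h ε hε).exists
        refine ⟨_, union_mem_of_sdiff_mem (hd.base.mem k) (hd.sdiff_mem k), ?_⟩
        convert hk using 2
        ext t
        simp [Set.mem_symmDiff]
        tauto
    intro ε hε
    obtain ⟨y, hy, hxy⟩ := happrox (ε / 2) (half_pos hε)
    obtain ⟨c, hc, hyc⟩ := hPγ y hy (ε / 2) (half_pos hε)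
    refine ⟨c, hc, ?_⟩
    have hyA := hsub _ hy
    have h1 : l (symmDiff (x γ) c) ≤ l (symmDiff (x γ) y ∪ symmDiff y c) :=
      hl.le_of_subset hpos (hsymm hxA (hBA hc))
        (A.supClosed (hsymm hxA hyA) (hsymm hyA (hBA hc))) (symmDiff_triangle _ _ _)
    have h2 := hl.union_le hpos (hsymm hxA hyA) (hsymm hyA (hBA hc))
    linarith
  exact hPcl Set.univ fun i _ => hPx i

/-- A set which destroys a sequence of measures at a late stage witnesses that the sequence is not
pointwise bounded. -/
theorem Destroys.not_bounded {B A : BooleanSubalgebra (Set ℕ)} {ν : ℕ → Set ℕ → ℝ}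
    {z : Set ℕ} {b : ℕ → Set ℕ} (hd : Destroys B ν z b) (hBA : B ≤ A) (hz : z ∈ A)
    (hadd : ∀ n, AdditiveOn A (ν n)) (hK : ∀ n, ∃ K, 0 < K ∧ ∀ a ∈ A, |ν n a| ≤ K * l a)
    (h : (∀ ε > 0, ∀ᶠ k in atTop, l (b k ∩ z) < ε) ∨ (∀ ε > 0, ∀ᶠ k in atTop, l (b k \ z) < ε))
    (M : ℝ) : ∃ n, M < |ν n z| := by
  have hbA : ∀ k, b k ∈ A := fun k => hBA (hd.base.mem k)
  rcases h with h | h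
  · obtain ⟨n, hn⟩ := hd.sdiff_large (M + 1)
    obtain ⟨K, hK0, hK⟩ := hK n
    obtain ⟨k, hk, hk'⟩ := (hn.and_eventually (h (1 / K) (by positivity))).exists
    refine ⟨n, ?_⟩
    have h1 := (hadd n).inter_add_sdiff hz (hbA k)
    have h2 : |ν n (z ∩ b k)| ≤ 1 := by
      rw [Set.inter_comm]
      refine (hK _ (A.infClosed (hbA k) hz)).trans ?_
      rw [lt_div_iff₀' hK0] at hk'
      exact hk'.le
    rw [← h1]
    have h3 := abs_sub (ν n (z ∩ b k) + ν n (z \ b k)) (ν n (z ∩ b k))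
    rw [add_sub_cancel_left] at h3
    linarith
  · obtain ⟨n, hn⟩ := hd.union_large (M + 1)
    obtain ⟨K, hK0, hK⟩ := hK n
    obtain ⟨k, hk, hk'⟩ := (hn.and_eventually (h (1 / K) (by positivity))).exists
    refine ⟨n, ?_⟩
    have hm := BooleanSubalgebra.sdiff_mem (hbA k) hz
    have h1 := hadd n _ hz _ hm Set.disjoint_sdiff_right
    have h2 : |ν n (b k \ z)| ≤ 1 := by
      refine (hK _ hm).trans ?_
      rw [lt_div_iff₀' hK0] at hk'
      exact hk'.le
    rw [Set.union_sdiff_self] at h1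
    rw [h1] at hk
    linarith [abs_add_le (ν n z) (ν n (b k \ z))]

end stabilization

theorem exists_mem_of_isStationary {S : Set CountableOrdinal} (hS : IsStationary S)
    (α : CountableOrdinal) : ∃ β ∈ S, α ≤ β := by
  have hclub : IsClub (Set.Ici α) := by
    refine ⟨fun d hd hne _ a ha => ?_, fun β => ⟨max α β, Set.mem_Ici.2 (le_max_left α β), le_max_right α β⟩⟩
    obtain ⟨c, hc⟩ := hne
    exact (Set.mem_Ici.1 (hd hc)).trans (ha.1 hc)
  obtain ⟨β, hβ, hαβ⟩ := hS hclub
  exact ⟨β, hβ, hαβ⟩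

/-! ### The Nikodym property -/

section nikodym

variable {f : GuessFamily} {x : CountableOrdinal → Set ℕ}

theorem uniformly_bounded_of_guess
    (hf : ∀ g : ℕ → CountableOrdinal → Bool, IsStationary {α : CountableOrdinal |
      ∃ hα : Ordinal.omega0 ≤ α.1, ∀ n : ℕ, ∀ β : Set.Iio α, g n β.1 = f α hα n β})
    (hx : ∀ α, (∃ z, DestroysGuess f α x z) → DestroysGuess f α x (x α))
    {ν : ℕ → Set ℕ → ℝ} (hadd : ∀ n, AdditiveOn (generatedAlgebra x Set.univ) (ν n))
    (hbdd : ∀ n, ∃ M, ∀ a ∈ generatedAlgebra x Set.univ, |ν n a| ≤ M)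
    (hpt : ∀ a ∈ generatedAlgebra x Set.univ, ∃ M, ∀ n, |ν n a| ≤ M) :
    ∃ M, ∀ n, ∀ a ∈ generatedAlgebra x Set.univ, |ν n a| ≤ M := by
  by_contra! hunb
  obtain ⟨l, hl, hpos, hK⟩ := exists_control hadd hbdd
  obtain ⟨α₀, hα₀⟩ := exists_forall_not_split hl hpos
  -- Countably many sets witness the unboundedness, so it is visible at every sufficiently late
  -- countable stage.
  choose n a ha hlarge using fun M : ℕ => hunb M
  have hne : (Set.univ : Set CountableOrdinal).Nonempty := ⟨α₀, trivial⟩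
  choose β _ hβ using fun M => exists_mem_generatedAlgebra_Iic hne (ha M)
  obtain ⟨α₁, hα₁⟩ := CountableOrdinal.exists_forall_le β
  obtain ⟨α₂, hα₂⟩ := α₁.exists_gt
  obtain ⟨α, ⟨hω, hguess⟩, hα⟩ := exists_mem_of_isStationary (hf (measureCode x ν)) (max α₀ α₂)
  have hsub : generatedAlgebra x (Set.Iio α) ≤ generatedAlgebra x Set.univ :=
    generatedAlgebra_mono (Set.subset_univ _)
  obtain ⟨z, b, hz⟩ := exists_destroys (countable_generatedAlgebra (x := x) α.countable_Iio)
    (fun n => (hadd n).mono hsub) (fun n => (hbdd n).imp fun M h a ha => h a (hsub ha))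
    (fun a ha => hpt a (hsub ha)) fun M => by
      obtain ⟨N, hN⟩ := exists_nat_gt M
      refine ⟨n N, a N, ?_, hN.trans (hlarge N)⟩
      refine generatedAlgebra_mono (fun γ hγ => ?_) (hβ N)
      exact (hγ.trans (hα₁ N)).trans_lt (hα₂.trans_le ((le_max_right _ _).trans hα))
  -- The recursion may have had another sequence `ν'` in mind, but equal codes force `ν'` and `ν` to
  -- agree on this stage.
  obtain ⟨_, ν', b', hcode, hd⟩ := hx α ⟨z, hω, ν, b, hguess, hz⟩
  have hIio : (Set.Iio α).Nonempty :=
    ⟨α₁, hα₂.trans_le ((le_max_right _ _).trans hα)⟩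
  have hd' : Destroys (generatedAlgebra x (Set.Iio α)) ν (x α) b' :=
    hd.congr fun n a ha => eq_of_measureCode_eq hIio
      (fun m β hβ => (hcode m ⟨β, hβ⟩).trans (hguess m ⟨β, hβ⟩).symm) n ha
  have hxA : x α ∈ generatedAlgebra x Set.univ := mem_generatedAlgebra trivial
  obtain ⟨M, hM⟩ := hpt _ hxA
  obtain ⟨n, hn⟩ := hd'.not_bounded hsub hxA hadd hK
    (hα₀ α ((le_max_left _ _).trans hα) b' hd'.base) M
  exact absurd (hM n) hn.not_ge

open Classical in
theorem nikodymProperty_of_sets {A : BooleanSubalgebra (Set ℕ)}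
    (h : ∀ ν : ℕ → Set ℕ → ℝ, (∀ n, AdditiveOn A (ν n)) → (∀ n, ∃ M, ∀ a ∈ A, |ν n a| ≤ M) →
      (∀ a ∈ A, ∃ M, ∀ n, |ν n a| ≤ M) → ∃ M, ∀ n, ∀ a ∈ A, |ν n a| ≤ M) :
    NikodymProperty A := by
  intro μ hμ
  let ν : ℕ → Set ℕ → ℝ := fun n s => if hs : s ∈ A then (μ n).toFun ⟨s, hs⟩ else 0
  have hν : ∀ n (a : A), ν n a = (μ n).toFun a := fun n a => dif_pos a.2
  have hunif := h ν ?_ ?_ ?_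
  · obtain ⟨M, hM⟩ := hunif
    refine ⟨M + M, ?_⟩
    rintro _ ⟨n, rfl⟩
    refine csSup_le ⟨_, ⊥, ⊥, disjoint_bot_left, rfl⟩ ?_
    rintro _ ⟨a, b, -, rfl⟩
    have h1 := hM n a a.2
    have h2 := hM n b b.2
    rw [hν] at h1 h2
    exact add_le_add h1 h2
  · intro n a ha b hb hab
    have := (μ n).map_sup_of_disjoint ⟨a, ha⟩ ⟨b, hb⟩ (by
      rw [disjoint_iff] at hab ⊢
      exact Subtype.ext hab)
    rw [← hν, ← hν, ← hν] at this
    exact this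
  · intro n
    obtain ⟨M, hM⟩ := (μ n).bounded
    refine ⟨M, fun a ha => ?_⟩
    have h1 : |(μ n).toFun ⟨a, ha⟩| + |(μ n).toFun ⊥| ≤ M :=
      hM ⟨⟨a, ha⟩, ⊥, disjoint_bot_right, rfl⟩
    rw [← hν] at h1
    linarith [abs_nonneg ((μ n).toFun ⊥)]
  · intro a ha
    obtain ⟨M, hM⟩ := hμ ⟨a, ha⟩
    refine ⟨M, fun n => ?_⟩
    have h1 := hM ⟨n, rfl⟩
    simp only [← hν] at h1
    exact h1

end nikodym

/-! ### Countable Maharam type and conclusion -/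

open Classical in
theorem maharamType_le_aleph0_of_sets {A : BooleanSubalgebra (Set ℕ)}
    (h : ∀ l : Set ℕ → ℝ, AdditiveOn A l → (∀ a ∈ A, 0 ≤ l a) →
      ∃ B ≤ A, (B : Set (Set ℕ)).Countable ∧
        ∀ a ∈ A, ∀ ε > 0, ∃ b ∈ B, l (symmDiff a b) < ε)
    (μ : Measure (StoneSpace A)) [IsProbabilityMeasure μ] [μ.Regular] :
    maharamType μ ≤ Cardinal.aleph0 := by
  let l : Set ℕ → ℝ := fun s => if hs : s ∈ A then μ.real (StoneSpace.basicClopen ⟨s, hs⟩) else 0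
  have hlA : ∀ a : A, l a = μ.real (StoneSpace.basicClopen a) := fun a => dif_pos a.2
  have hl : AdditiveOn A l := by
    intro a ha b hb hab
    have hab' : (⟨a, ha⟩ : A) ⊓ ⟨b, hb⟩ = ⊥ := Subtype.ext (disjoint_iff.1 hab)
    have h1 : l (a ∪ b) = μ.real (StoneSpace.basicClopen ((⟨a, ha⟩ : A) ⊔ ⟨b, hb⟩)) :=
      hlA (⟨a, ha⟩ ⊔ ⟨b, hb⟩)
    rw [h1, StoneSpace.basicClopen_sup, measureReal_union _
      (StoneSpace.measurableSet_basicClopen _), ← hlA, ← hlA]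
    rw [Set.disjoint_iff_inter_eq_empty, ← StoneSpace.basicClopen_inf, hab',
      StoneSpace.basicClopen_bot]
  have hpos : ∀ a ∈ A, 0 ≤ l a := fun a ha => by
    rw [hlA ⟨a, ha⟩]
    exact measureReal_nonneg
  obtain ⟨B, hBA, hB, hdense⟩ := h l hl hpos
  have hS : {a : A | (a : Set ℕ) ∈ B}.Countable := hB.preimage Subtype.val_injective
  refine StoneSpace.maharamType_le_aleph0 hS fun a ε hε => ?_
  obtain ⟨δ, hδ, hδε⟩ := ENNReal.lt_iff_exists_real_btwn.1 hε
  obtain ⟨b, hb, hab⟩ := hdense a a.2 δ (by simpa using hδε.1)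
  have hbA : b ∈ A := hBA hb
  refine ⟨⟨b, hbA⟩, hb, lt_trans ?_ hδε.2⟩
  have h1 : l (symmDiff (a : Set ℕ) b) =
      μ.real (StoneSpace.basicClopen (symmDiff a ⟨b, hbA⟩)) := hlA (symmDiff a ⟨b, hbA⟩)
  rw [h1] at hab
  rwa [measureReal_def, ← ENNReal.lt_ofReal_iff_toReal_lt (measure_ne_top μ _)] at hab

theorem corollary4p5 (hdiamond : DiamondPrinciple) :
    ∃ (A : Type) (_ : BooleanAlgebra A), Infinite A ∧ NikodymProperty A ∧
      ∀ μ : Measure (StoneSpace A), IsProbabilityMeasure μ → μ.Regular →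
        maharamType μ ≤ Cardinal.aleph0 := by
  obtain ⟨f, hf⟩ := hdiamond
  obtain ⟨x, hx⟩ := exists_generators f
  refine ⟨generatedAlgebra x Set.univ, inferInstance, ?_, ?_, fun μ _ _ => ?_⟩
  · exact Infinite.of_injective (β := ℕ)
      (fun n => ⟨{n}, singleton_mem_generatedAlgebra n⟩) fun m n hmn =>
        Set.singleton_injective (Subtype.ext_iff.1 hmn)
  · exact nikodymProperty_of_sets fun ν hadd hbdd hpt =>
      uniformly_bounded_of_guess hf (fun α => (hx α).2) hadd hbdd hpt
  · refine maharamType_le_aleph0_of_sets (fun l hl hpos => ?_) μ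
    obtain ⟨α, hα⟩ := exists_dense_stage
      (fun α => (hx α).1.imp_right fun ⟨_, ν, b, _, hd⟩ => ⟨ν, b, hd⟩) hl hpos
    exact ⟨_, generatedAlgebra_mono (Set.subset_univ _),
      countable_generatedAlgebra α.countable_Iio, hα⟩
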